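/- Let $X$ be a regular $T_1$ topological space. Let $CL(X)$ be the set of all non-empty closed subsets of $X$, let $CL_\emptyset(X)=CL(X)\cup\{\emptyset\}$, and for $n\ge 1$ let $\mathcal F_n(X)$ be the set of all non-empty subsets of $X$ with at most $n$ points. Equip $CL_\emptyset(X)$ with the Fell topology $\tau_F$, which has as a subbase the sets $U^-=\{H\in CL_\emptyset(X): H\cap U\ne\emptyset\}$ with $U\subseteq X$ non-empty and open, together with the sets $(K^c)^+=\{H\in CL_\emptyset(X): H\cap K=\emptyset\}$ with $K\subseteq X$ compact and $K\neq X$; equip $\mathcal F_n(X)\cup\{\emptyset\}$ with the subspace topology, also denoted $\tau_F$. A topological space $Y$ is a $D_1$-space if every closed $C\subseteq Y$ has a countable local base, i.e. there is a countable family $\mathcal B$ of open sets containing $C$ such that every open set containing $C$ contains a member of $\mathcal B$. Then the following statements are equivalent: 1. $(CL_\emptyset(X),\tau_F)$ is a $D_1$-space; 2. $(\mathcal F_n(X)\cup\{\emptyset\},\tau_F)$ is a $D_1$-space for some $n\ge 2$; 3. $X$ is locally compact, separable and metrizable. -/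

import Mathlib

open Set TopologicalSpace

universe u

/-- A topological space is a `D₁`-space if every closed subset has a countable local base. -/
def IsDOneSpace (Y : Type u) [TopologicalSpace Y] : Prop :=
  ∀ C : Set Y, IsClosed C → ∃ B : Set (Set Y), B.Countable ∧
    (∀ V ∈ B, IsOpen V ∧ C ⊆ V) ∧ ∀ W : Set Y, IsOpen W → C ⊆ W → ∃ V ∈ B, V ⊆ W

/-- `CL(X) ∪ {∅}`: all closed subsets of `X`, the empty one included. -/
def CLEmpty (X : Type u) [TopologicalSpace X] : Type u := {H : Set X // IsClosed H}

namespace CLEmpty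

variable (X : Type u) [TopologicalSpace X]

/-- `U⁻`: the closed sets meeting `U`. -/
def hit (U : Set X) : Set (CLEmpty X) := {H | (H.1 ∩ U).Nonempty}

/-- `U⁺`: the closed sets contained in `U`. -/
def inside (U : Set X) : Set (CLEmpty X) := {H | H.1 ⊆ U}

/-- The Fell topology, generated by the sets `U⁻` with `U` non-empty and open, and the sets
`(Kᶜ)⁺` with `K ≠ X` compact. -/
instance fellTopology : TopologicalSpace (CLEmpty X) :=
  generateFrom
    ({S | ∃ U : Set X, IsOpen U ∧ U.Nonempty ∧ S = hit X U} ∪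
      {S | ∃ K : Set X, IsCompact K ∧ K ≠ univ ∧ S = inside X Kᶜ})

/-- The empty set, as a point of `CL(X) ∪ {∅}`. -/
def emptyPoint : CLEmpty X := ⟨∅, isClosed_empty⟩

/-- `F_n(X)`: the non-empty subsets of `X` with at most `n` points (in a `T₁` space they are all
closed). -/
def finitePoints (n : ℕ) : Set (CLEmpty X) := {A | A.1.Nonempty ∧ A.1.encard ≤ n}

end CLEmpty

open Filter Topology

/-! If `X` is locally compact and second countable, its Fell hyperspace is compact and second
countable, and finite unions of basic open sets then form a countable local base at any closed set.
The property passes to closed subspaces, in particular to the sets with at most two points.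
Conversely, three closed sets carry the argument. A local base at `∅` yields countably many compact
sets cofinal among the proper ones; a local base at `{x}` gives first countability at `x`, and the
two force local compactness and σ-compactness. A local base at the sets with at most one point,
pulled back along `(x, y) ↦ {x, y}`, makes each compact subset of `X` metrizable, so `X` is second
countable. -/

/-- A compact second countable space is a `D₁`-space. -/
theorem IsDOneSpace.of_compactSpace {Y : Type u} [TopologicalSpace Y] [CompactSpace Y]
    [SecondCountableTopology Y] : IsDOneSpace Y := by
  intro C hC
  refine ⟨sUnion '' {F : Set (Set Y) | F.Finite ∧ F ⊆ countableBasis Y} ∩ {V | C ⊆ V},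
    ((countable_ofPred_finite_subset (countable_countableBasis Y)).image _).mono inter_subset_left,
    ?_, ?_⟩
  · rintro _ ⟨⟨F, ⟨-, hF⟩, rfl⟩, hCF⟩
    exact ⟨isOpen_sUnion fun s hs => isOpen_of_mem_countableBasis (hF hs), hCF⟩
  · intro W hW hCW
    obtain ⟨F, hF, hfin, hCF⟩ := hC.isCompact.elim_finite_subcover_image
      (b := {b | b ∈ countableBasis Y ∧ b ⊆ W}) (c := id)
      (fun b hb => isOpen_of_mem_countableBasis hb.1) (fun x hx => by
        obtain ⟨b, hb, hxb, hbW⟩ :=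
          (isBasis_countableBasis Y).exists_subset_of_mem_open (hCW hx) hW
        exact mem_biUnion (show b ∈ {b | b ∈ countableBasis Y ∧ b ⊆ W} from ⟨hb, hbW⟩) hxb)
    refine ⟨⋃₀ F, ⟨⟨F, ⟨hfin, fun b hb => (hF hb).1⟩, rfl⟩, ?_⟩,
      sUnion_subset fun b hb => (hF hb).2⟩
    simpa [sUnion_eq_biUnion] using hCF

/-- The traces on a `D₁`-subspace `S` of a closed set have a countable local base. -/
theorem IsDOneSpace.exists_seq {Z : Type u} [TopologicalSpace Z] {S : Set Z} (h : IsDOneSpace S)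
    {C : Set Z} (hC : IsClosed C) : ∃ V : ℕ → Set Z, (∀ i, IsOpen (V i) ∧ C ∩ S ⊆ V i) ∧
      ∀ W, IsOpen W → C ∩ S ⊆ W → ∃ i, V i ∩ S ⊆ W := by
  obtain ⟨B, hB, hBo, hBW⟩ := h (Subtype.val ⁻¹' C) (hC.preimage continuous_subtype_val)
  have hne : B.Nonempty := by
    obtain ⟨V, hV, -⟩ := hBW univ isOpen_univ (subset_univ _)
    exact ⟨V, hV⟩
  obtain ⟨f, rfl⟩ := hB.exists_eq_range hne
  choose V hV hVf using fun i => isOpen_induced_iff.1 (hBo (f i) (mem_range_self i)).1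
  refine ⟨V, fun i => ⟨hV i, fun x hx => ?_⟩, fun W hW hCW => ?_⟩
  · have : (⟨x, hx.2⟩ : S) ∈ f i := (hBo (f i) (mem_range_self i)).2 hx.1
    rwa [← hVf i] at this
  · obtain ⟨_, ⟨i, rfl⟩, hi⟩ := hBW (Subtype.val ⁻¹' W) (hW.preimage continuous_subtype_val)
      (fun x hx => hCW ⟨hx, x.2⟩)
    refine ⟨i, fun x hx => hi (a := ⟨x, hx.2⟩) ?_⟩
    rw [← hVf i]
    exact hx.1

/-- Closed subspaces of `D₁`-spaces are `D₁`-spaces. -/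
theorem IsDOneSpace.subtype {Z : Type u} [TopologicalSpace Z] (h : IsDOneSpace Z) {S : Set Z}
    (hS : IsClosed S) : IsDOneSpace S := by
  intro C hC
  obtain ⟨B, hB, hBo, hBW⟩ := h (Subtype.val '' C) (hS.isClosedMap_subtype_val C hC)
  refine ⟨(Subtype.val ⁻¹' ·) '' B, hB.image _, ?_, fun W hW hCW => ?_⟩
  · rintro _ ⟨V, hV, rfl⟩
    exact ⟨(hBo V hV).1.preimage continuous_subtype_val, image_subset_iff.1 (hBo V hV).2⟩
  · obtain ⟨W', hW', rfl⟩ := isOpen_induced_iff.1 hW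
    obtain ⟨V, hV, hVW⟩ := hBW W' hW' (image_subset_iff.2 hCW)
    exact ⟨_, mem_image_of_mem _ hV, preimage_mono hVW⟩

namespace CLEmpty

variable {X : Type u} [TopologicalSpace X]

/-! ### Compactness and second countability of the Fell topology -/

theorem isOpen_hit {U : Set X} (hU : IsOpen U) : IsOpen (hit X U) := by
  rcases U.eq_empty_or_nonempty with rfl | hne
  · convert isOpen_empty
    ext H
    simp [hit]
  · exact .basic _ (.inl ⟨U, hU, hne, rfl⟩)

theorem isOpen_inside_compl {K : Set X} (hK : IsCompact K) (hne : K ≠ univ) :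
    IsOpen (inside X Kᶜ) :=
  .basic _ (.inr ⟨K, hK, hne, rfl⟩)

/-- An ultrafilter converges to the set of points all of whose open neighbourhoods are hit by almost
every member. A compact set missing this limit is covered by finitely many open sets that almost
every member avoids. No separation is needed. -/
instance : CompactSpace (CLEmpty X) := by
  refine ⟨isCompact_iff_ultrafilter_le_nhds.2 fun f _ => ?_⟩
  let H : Set X := {x | ∀ U, IsOpen U → x ∈ U → hit X U ∈ f}
  have hH : IsClosed H := by
    refine isClosed_of_closure_subset fun x hx U hU hxU => ?_
    obtain ⟨y, hyU, hy⟩ := mem_closure_iff.1 hx U hU hxU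
    exact hy U hU hyU
  refine ⟨⟨H, hH⟩, mem_univ _, ?_⟩
  refine tendsto_id'.1 (tendsto_nhds_generateFrom_iff.2 ?_)
  rintro _ (⟨U, hU, -, rfl⟩ | ⟨K, hK, -, rfl⟩) hmem
  · obtain ⟨x, hx, hxU⟩ := hmem
    exact hx U hU hxU
  · have : ∀ x ∈ K, ∃ U, IsOpen U ∧ x ∈ U ∧ hit X U ∉ f := by
      intro x hx
      have : x ∉ H := fun h => hmem h hx
      simpa [H] using this
    choose! U hU hxU hUf using this
    obtain ⟨t, htK, ht⟩ := hK.elim_nhds_subcover U fun x hx => (hU x hx).mem_nhds (hxU x hx)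
    have key : (⋂ x ∈ t, (hit X (U x))ᶜ) ∈ f :=
      (biInter_finset_mem t).2 fun x hx => Ultrafilter.compl_mem_iff_notMem.2 (hUf x (htK x hx))
    refine mem_of_superset key fun A hA x hxA hxK => ?_
    obtain ⟨y, hy, hxy⟩ := mem_iUnion₂.1 (ht hxK)
    exact mem_iInter₂.1 hA y hy ⟨x, hxA, hxy⟩

theorem exists_finite_subset_countableBasis [SecondCountableTopology X] [LocallyCompactSpace X]
    [R1Space X] {K O : Set X} (hK : IsCompact K) (hO : IsOpen O) (hKO : K ⊆ O) :
    ∃ F ⊆ countableBasis X, F.Finite ∧ K ⊆ closure (⋃₀ F) ∧ IsCompact (closure (⋃₀ F)) ∧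
      closure (⋃₀ F) ⊆ O := by
  obtain ⟨M, hM, hMc, hKM, hMO⟩ := exists_compact_closed_between hK hO hKO
  obtain ⟨F, hF, hfin, hKF⟩ := hK.elim_finite_subcover_image
      (b := {b | b ∈ countableBasis X ∧ b ⊆ M}) (c := id)
      (fun b hb => isOpen_of_mem_countableBasis hb.1) (fun x hx => by
        obtain ⟨b, hb, hxb, hbW⟩ :=
          (isBasis_countableBasis X).exists_subset_of_mem_open (hKM hx) isOpen_interior
        exact mem_biUnion (show b ∈ {b | b ∈ countableBasis X ∧ b ⊆ M} from
          ⟨hb, hbW.trans interior_subset⟩) hxb)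
  have hFM : closure (⋃₀ F) ⊆ M := closure_minimal (sUnion_subset fun b hb => (hF hb).2) hMc
  refine ⟨F, fun b hb => (hF hb).1, hfin, ?_, hM.of_isClosed_subset isClosed_closure hFM,
    hFM.trans hMO⟩
  refine subset_trans ?_ subset_closure
  simpa [sUnion_eq_biUnion] using hKF

instance [SecondCountableTopology X] [LocallyCompactSpace X] [T2Space X] :
    SecondCountableTopology (CLEmpty X) := by
  let S : Set (Set (CLEmpty X)) := hit X '' countableBasis X ∪
    (fun F => inside X (closure (⋃₀ F))ᶜ) '' {F | (F.Finite ∧ F ⊆ countableBasis X) ∧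
      IsCompact (closure (⋃₀ F)) ∧ closure (⋃₀ F) ≠ univ}
  refine ⟨S, ?_, le_antisymm (le_generateFrom ?_) (le_generateFrom ?_)⟩
  · exact ((countable_countableBasis X).image _).union
      (((countable_ofPred_finite_subset (countable_countableBasis X)).mono fun F hF => hF.1).image _)
  · rintro _ (⟨U, hU, rfl⟩ | ⟨F, ⟨-, hF, hne⟩, rfl⟩)
    · exact isOpen_hit (isOpen_of_mem_countableBasis hU)
    · exact isOpen_inside_compl hF hne
  · rintro _ (⟨U, hU, -, rfl⟩ | ⟨K, hK, hne, rfl⟩) <;>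
      refine (@isOpen_iff_forall_mem_open _ (generateFrom S) _).2 fun H hH => ?_
    · obtain ⟨x, hxH, hxU⟩ := hH
      obtain ⟨b, hb, hxb, hbU⟩ := (isBasis_countableBasis X).exists_subset_of_mem_open hxU hU
      exact ⟨hit X b, fun A ⟨y, hyA, hyb⟩ => ⟨y, hyA, hbU hyb⟩,
        .basic _ (.inl (mem_image_of_mem _ hb)), x, hxH, hxb⟩
    · obtain ⟨x, hx⟩ := (ne_univ_iff_exists_notMem K).1 hne
      -- A proper `O` keeps the compact set found below it different from `X`, as the subbase
      -- requires; for empty `H` a point outside `K` is removed.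
      have key : ∃ O : Set X, IsOpen O ∧ K ⊆ O ∧ H.1 ⊆ Oᶜ ∧ O ≠ univ := by
        rcases H.1.eq_empty_or_nonempty with h0 | ⟨y, hy⟩
        · exact ⟨{x}ᶜ, isOpen_compl_singleton, fun y hy hyx => hx (hyx ▸ hy), by simp [h0],
            (ne_univ_iff_exists_notMem _).2 ⟨x, by simp⟩⟩
        · exact ⟨H.1ᶜ, H.2.isOpen_compl, fun z hz hzH => hH hzH hz, by simp,
            (ne_univ_iff_exists_notMem _).2 ⟨y, by simpa using hy⟩⟩
      obtain ⟨O, hO, hKO, hHO, hOne⟩ := key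
      obtain ⟨F, hFb, hFfin, hKF, hFc, hFO⟩ := exists_finite_subset_countableBasis hK hO hKO
      refine ⟨inside X (closure (⋃₀ F))ᶜ, fun A hA => hA.trans (compl_subset_compl.2 hKF),
        .basic _ (.inr ⟨F, ⟨⟨hFfin, hFb⟩, hFc, fun h => hOne ?_⟩, rfl⟩),
        hHO.trans (compl_subset_compl.2 hFO)⟩
      exact univ_subset_iff.1 (h ▸ hFO)

/-! ### Separation and finite sets in the hyperspace -/

/-- In a Hausdorff space, having at most `n` points is a closed condition. -/
theorem isClosed_setOf_encard_le [T2Space X] (n : ℕ) :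
    IsClosed {A : CLEmpty X | A.1.encard ≤ n} := by
  refine isOpen_compl_iff.1 (isOpen_iff_forall_mem_open.2 fun A hA => ?_)
  have hA : (n : ℕ∞) < A.1.encard := not_le.1 hA
  -- Disjoint neighbourhoods of `n + 1` points of `A` force every set hitting all of them to have
  -- more than `n` points.
  obtain ⟨t, htA, ht⟩ := exists_subset_encard_eq (Order.add_one_le_of_lt hA)
  have htfin : t.Finite := finite_of_encard_eq_coe (k := n + 1) (by simpa using ht)
  obtain ⟨U, hU, hdisj⟩ := htfin.t2_separation
  refine ⟨⋂ x ∈ t, hit X (U x), fun B hB hBn => ?_,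
    htfin.isOpen_biInter fun x _ => isOpen_hit (hU x).2,
    mem_iInter₂.2 fun x hx => ⟨x, htA hx, (hU x).1⟩⟩
  have : ∀ x ∈ t, ∃ y, y ∈ B.1 ∧ y ∈ U x := fun x hx => mem_iInter₂.1 hB x hx
  choose! f hfB hfU using this
  have hinj : InjOn f t := fun x hx y hy hxy => by
    by_contra hne
    exact disjoint_left.1 (hdisj hx hy hne) (hfU x hx) (hxy ▸ hfU y hy)
  have h1 : t.encard ≤ B.1.encard :=
    hinj.encard_image ▸ encard_le_encard (image_subset_iff.2 fun x hx => hfB x hx)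
  have h2 : t.encard ≤ n := h1.trans hBn
  rw [ht] at h2
  exact absurd h2 (not_le.2 (by exact_mod_cast Nat.lt_succ_self n))

theorem finitePoints_union_emptyPoint (n : ℕ) :
    finitePoints X n ∪ {emptyPoint X} = {A : CLEmpty X | A.1.encard ≤ n} := by
  ext A
  constructor
  · rintro (h | rfl)
    · exact h.2
    · exact (encard_empty (α := X)).trans_le zero_le
  · intro h
    rcases A.1.eq_empty_or_nonempty with h0 | h0
    · exact .inr (Subtype.ext h0)
    · exact .inl ⟨h0, h⟩

instance [T1Space X] [Nontrivial X] : T1Space (CLEmpty X) := by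
  refine ⟨fun A => isOpen_compl_iff.1 (isOpen_iff_forall_mem_open.2 fun B hBA => ?_)⟩
  by_cases h : B.1 ⊆ A.1
  · obtain ⟨x, hxA, hxB⟩ := not_subset.1 fun h' => hBA (Subtype.ext (h.antisymm h'))
    refine ⟨inside X {x}ᶜ, ?_, isOpen_inside_compl isCompact_singleton (singleton_ne_univ x),
      subset_compl_singleton_iff.2 hxB⟩
    rintro C hC rfl
    exact hC hxA rfl
  · obtain ⟨x, hxB, hxA⟩ := not_subset.1 h
    refine ⟨hit X A.1ᶜ, ?_, isOpen_hit A.2.isOpen_compl, x, hxB, hxA⟩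
    rintro C ⟨y, hyC, hyA⟩ rfl
    exact hyA hyC

instance [T2Space X] [LocallyCompactSpace X] [Nontrivial X] : T2Space (CLEmpty X) := by
  have key : ∀ A B : CLEmpty X, ¬ A.1 ⊆ B.1 →
      ∃ u v : Set (CLEmpty X), IsOpen u ∧ IsOpen v ∧ A ∈ u ∧ B ∈ v ∧ Disjoint u v := by
    intro A B h
    obtain ⟨x, hxA, hxB⟩ := not_subset.1 h
    obtain ⟨O, hO, hxO, hBO, hOne⟩ :
        ∃ O : Set X, IsOpen O ∧ x ∈ O ∧ B.1 ⊆ Oᶜ ∧ O ≠ univ := by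
      rcases B.1.eq_empty_or_nonempty with h0 | ⟨y, hy⟩
      · obtain ⟨y, hy⟩ := exists_ne x
        exact ⟨{y}ᶜ, isOpen_compl_singleton, hy.symm, by simp [h0],
          (ne_univ_iff_exists_notMem _).2 ⟨y, by simp⟩⟩
      · exact ⟨B.1ᶜ, B.2.isOpen_compl, hxB, by simp,
          (ne_univ_iff_exists_notMem _).2 ⟨y, by simpa using hy⟩⟩
    obtain ⟨K, hK, hxK, hKO⟩ := exists_compact_subset hO hxO
    refine ⟨hit X (interior K), inside X Kᶜ, isOpen_hit isOpen_interior,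
      isOpen_inside_compl hK fun h => hOne (univ_subset_iff.1 (h ▸ hKO)), ⟨x, hxA, hxK⟩,
      hBO.trans (compl_subset_compl.2 hKO), disjoint_left.2 ?_⟩
    rintro C ⟨y, hyC, hyK⟩ hC
    exact hC hyC (interior_subset hyK)
  refine ⟨fun A B hAB => ?_⟩
  by_cases h : A.1 ⊆ B.1
  · obtain ⟨u, v, hu, hv, hBu, hAv, huv⟩ := key B A fun h' => hAB (Subtype.ext (h.antisymm h'))
    exact ⟨v, u, hv, hu, hAv, hBu, huv.symm⟩
  · exact key A B h

/-- The point `{x, y}` of `CL(X)`. -/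
def pair [T1Space X] (p : X × X) : CLEmpty X := ⟨{p.1, p.2}, (toFinite _).isClosed⟩

theorem continuous_pair [T2Space X] : Continuous (pair (X := X)) := by
  refine continuous_generateFrom_iff.2 ?_
  rintro _ (⟨U, hU, -, rfl⟩ | ⟨K, hK, -, rfl⟩)
  · convert (hU.preimage continuous_fst).union (hU.preimage (continuous_snd (X := X) (Y := X)))
    ext p
    simp [pair, hit, Set.Nonempty]
  · convert (hK.isClosed.isOpen_compl.preimage continuous_fst).inter
      (hK.isClosed.isOpen_compl.preimage (continuous_snd (X := X) (Y := X)))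
    ext p
    simp [pair, inside, insert_subset_iff]

/-- No `U⁻` contains `∅`, so only the conditions of avoiding a compact set matter near `∅`. -/
theorem exists_isCompact_inside_subset {V : Set (CLEmpty X)} (hV : IsOpen V)
    (h : emptyPoint X ∈ V) : ∃ L : Set X, IsCompact L ∧ inside X Lᶜ ⊆ V := by
  induction hV with
  | basic s hs =>
    rcases hs with ⟨U, -, -, rfl⟩ | ⟨K, hK, -, rfl⟩
    · obtain ⟨x, hx, -⟩ := h
      exact hx.elim
    · exact ⟨K, hK, Subset.rfl⟩
  | univ => exact ⟨∅, isCompact_empty, subset_univ _⟩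
  | inter s t _ _ ihs iht =>
    obtain ⟨L, hL, hLs⟩ := ihs h.1
    obtain ⟨M, hM, hMt⟩ := iht h.2
    refine ⟨L ∪ M, hL.union hM, fun A hA => ⟨hLs fun x hx hxL => hA hx (.inl hxL),
      hMt fun x hx hxM => hA hx (.inr hxM)⟩⟩
  | sUnion S _ ih =>
    obtain ⟨s, hs, hes⟩ := h
    obtain ⟨L, hL, hLs⟩ := ih s hs hes
    exact ⟨L, hL, hLs.trans (subset_sUnion_of_mem hs)⟩

/-! ### What countable local bases say about the base space -/

section

variable {S : Set (CLEmpty X)}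

/-- A local base at `∅` gives a countable cofinal family of compact sets. -/
theorem exists_seq_isCompact [T1Space X] [Nontrivial X] (hS : IsDOneSpace S)
    (h0 : emptyPoint X ∈ S) (hpair : ∀ p, pair p ∈ S) :
    ∃ L : ℕ → Set X, (∀ i, IsCompact (L i)) ∧
      ∀ K, IsCompact K → K ≠ univ → ∃ i, K ⊆ L i := by
  obtain ⟨V, hV, hVW⟩ := hS.exists_seq (isClosed_singleton (x := emptyPoint X))
  choose L hL hLV using fun i => exists_isCompact_inside_subset (hV i).1 ((hV i).2 ⟨rfl, h0⟩)
  refine ⟨L, hL, fun K hK hne => ?_⟩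
  obtain ⟨i, hi⟩ := hVW _ (isOpen_inside_compl hK hne) (by
    rintro _ ⟨rfl, -⟩
    exact empty_subset _)
  refine ⟨i, fun x hx => ?_⟩
  by_contra hxL
  -- The singleton `{x}` avoids `L i`, hence must avoid `K`.
  have hxx : (pair (x, x)).1 ⊆ (L i)ᶜ := by simpa [pair] using hxL
  have : pair (x, x) ∈ inside X Kᶜ := hi ⟨hLV i hxx, hpair _⟩
  exact this (a := x) (by simp [pair]) hx

theorem firstCountableTopology [T2Space X] [Nontrivial X] (hS : IsDOneSpace S)
    (hpair : ∀ p, pair p ∈ S) : FirstCountableTopology X := by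
  refine ⟨fun x => ?_⟩
  obtain ⟨V, hV, hVW⟩ := hS.exists_seq (isClosed_singleton (x := pair (x, x)))
  have hc : Continuous fun y : X => pair (y, y) :=
    continuous_pair.comp (continuous_id.prodMk continuous_id)
  refine (HasBasis.mk (p := fun _ : ℕ => True)
    (s := fun i => (fun y : X => pair (y, y)) ⁻¹' V i) fun t => ?_).isCountablyGenerated
  constructor
  · intro ht
    obtain ⟨U, hUt, hU, hxU⟩ := mem_nhds_iff.1 ht
    obtain ⟨i, hi⟩ := hVW _ (isOpen_hit hU) (by
      rintro _ ⟨rfl, -⟩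
      exact ⟨x, by simp [pair], hxU⟩)
    refine ⟨i, trivial, fun y hy => hUt ?_⟩
    obtain ⟨z, hz, hzU⟩ := hi ⟨hy, hpair _⟩
    have : z = y := by simpa [pair] using hz
    exact this ▸ hzU
  · rintro ⟨i, -, hi⟩
    exact mem_of_superset (((hV i).1.preimage hc).mem_nhds ((hV i).2 ⟨rfl, hpair _⟩)) hi

end

/-- A first countable Hausdorff space with a countable cofinal family of compact sets is locally
compact. -/
theorem locallyCompactSpace_of_seq_isCompact [T2Space X] [FirstCountableTopology X]
    {L : ℕ → Set X} (hL : ∀ i, IsCompact (L i))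
    (hcof : ∀ K, IsCompact K → K ≠ univ → ∃ i, K ⊆ L i) : LocallyCompactSpace X := by
  suffices WeaklyLocallyCompactSpace X from inferInstance
  refine ⟨fun x => ?_⟩
  by_contra! hx
  obtain ⟨U, hU⟩ := (𝓝 x).exists_antitone_basis
  have hM : ∀ n, IsCompact (⋃ i ∈ Iic n, L i) := fun n =>
    (finite_Iic n).isCompact_biUnion fun i _ => hL i
  -- The points `y n` converge to `x`, so with `x` they form a compact set, yet `y i ∉ L i` for
  -- every `i`.
  have : ∀ n, ∃ y ∈ U n, y ∉ ⋃ i ∈ Iic n, L i := fun n => not_subset.1 fun h =>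
    hx _ (hM n) (mem_of_superset (hU.mem n) h)
  choose y hyU hyL using this
  have hK : IsCompact (insert x (range y)) := (hU.tendsto hyU).isCompact_insert_range
  by_cases h : insert x (range y) = univ
  · exact hx _ hK (h ▸ univ_mem)
  · obtain ⟨i, hi⟩ := hcof _ hK h
    exact hyL i (mem_biUnion (mem_Iic.2 le_rfl) (hi (mem_insert_of_mem _ (mem_range_self i))))

/-- A local base at the sets with at most one point gives one at the diagonal of `L × L`, for
every compact `L`. -/
theorem secondCountableTopology_of_isCompact [T2Space X] [LocallyCompactSpace X] [Nontrivial X]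
    {S : Set (CLEmpty X)} (hS : IsDOneSpace S) (hpair : ∀ p, pair p ∈ S) {L : Set X}
    (hL : IsCompact L) : SecondCountableTopology L := by
  have := isCompact_iff_compactSpace.1 hL
  obtain ⟨V, hV, hVW⟩ := hS.exists_seq (isClosed_setOf_encard_le (X := X) 1)
  let g : L × L → CLEmpty X := fun p => pair (p.1.1, p.2.1)
  have hg : Continuous g := continuous_pair.comp (by fun_prop)
  let : UniformSpace L := uniformSpaceOfCompactR1
  have hbasis : (uniformity L).HasBasis (fun _ : ℕ => True) fun i => g ⁻¹' V i := by
    rw [← nhdsSet_diagonal_eq_uniformity]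
    refine ⟨fun t => ⟨fun ht => ?_, ?_⟩⟩
    · obtain ⟨W, hW, hdW, hWt⟩ := mem_nhdsSet_iff_exists.1 ht
      -- A compact image in the Hausdorff hyperspace; it consists of genuine two-point sets because
      -- `W` contains the diagonal.
      have hcl : IsClosed (g '' Wᶜ) := (hW.isClosed_compl.isCompact.image hg).isClosed
      obtain ⟨i, hi⟩ := hVW _ hcl.isOpen_compl (by
        rintro _ ⟨hA, -⟩ ⟨p, hp, rfl⟩
        have hne : p.1.1 ≠ p.2.1 := fun h => hp (hdW (Subtype.ext h))
        have : ({p.1.1, p.2.1} : Set X).encard ≤ (1 : ℕ) := hA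
        rw [encard_pair hne] at this
        exact absurd this (by decide))
      refine ⟨i, trivial, fun p hp => hWt ?_⟩
      by_contra hpW
      exact hi ⟨hp, hpair _⟩ (mem_image_of_mem g hpW)
    · rintro ⟨i, -, hi⟩
      refine mem_nhdsSet_iff_exists.2 ⟨_, (hV i).1.preimage hg, ?_, hi⟩
      rintro ⟨a, b⟩ hab
      obtain rfl : a = b := hab
      have h1 : (g (a, a)).1.encard ≤ (1 : ℕ) := by simp [g, pair]
      exact (hV i).2 ⟨h1, hpair _⟩
  have := hbasis.isCountablyGenerated
  exact UniformSpace.secondCountable_of_separable L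

theorem pair_mem_finitePoints [T1Space X] {n : ℕ} (hn : 2 ≤ n) (p : X × X) :
    pair p ∈ finitePoints X n :=
  ⟨⟨p.1, by simp [pair]⟩, by
    refine (encard_insert_le _ _).trans ?_
    rw [encard_singleton, one_add_one_eq_two]
    exact_mod_cast hn⟩

end CLEmpty

open CLEmpty in
theorem theoremt13 (X : Type u) [TopologicalSpace X] [T1Space X] [RegularSpace X] :
    List.TFAE [
      IsDOneSpace (CLEmpty X),
      ∃ n : ℕ, 2 ≤ n ∧
        IsDOneSpace ↥(CLEmpty.finitePoints X n ∪ {CLEmpty.emptyPoint X}),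
      LocallyCompactSpace X ∧ SeparableSpace X ∧ MetrizableSpace X] := by
  have : T3Space X := {}
  tfae_have 1 → 2 := fun h => ⟨2, le_rfl, h.subtype (by
    rw [finitePoints_union_emptyPoint]
    exact isClosed_setOf_encard_le 2)⟩
  tfae_have 2 → 3 := by
    rintro ⟨n, hn, h⟩
    -- If `X` is a single point, the hyperspace is not `T₁`, since `K ≠ X` leaves only `K = ∅`.
    rcases subsingleton_or_nontrivial X with hX | hX
    · exact ⟨inferInstance, inferInstance, inferInstance⟩
    have hpair : ∀ p, pair p ∈ finitePoints X n ∪ {emptyPoint X} := fun p =>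
      .inl (pair_mem_finitePoints hn p)
    obtain ⟨L, hL, hcof⟩ := exists_seq_isCompact h (.inr rfl) hpair
    have := firstCountableTopology h hpair
    have := locallyCompactSpace_of_seq_isCompact hL hcof
    have : SigmaCompactSpace X := ⟨⟨L, hL, eq_univ_of_forall fun x =>
      mem_iUnion.2 ((hcof {x} isCompact_singleton (singleton_ne_univ x)).imp
        fun i hi => hi rfl)⟩⟩
    let E : CompactExhaustion X := default
    have : ∀ i, SecondCountableTopology (interior (E i)) := fun i =>
      have := secondCountableTopology_of_isCompact h hpair (E.isCompact i)
      (IsEmbedding.inclusion (interior_subset (s := E i))).secondCountableTopology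
    have : SecondCountableTopology X :=
      secondCountableTopology_of_countable_cover (fun i => isOpen_interior (s := E i))
        (eq_univ_of_forall fun x => (E.exists_mem_nhds x).elim fun i hi =>
          mem_iUnion.2 ⟨i, mem_interior_iff_mem_nhds.2 hi⟩)
    exact ⟨inferInstance, inferInstance, inferInstance⟩
  tfae_have 3 → 1 := by
    rintro ⟨_, _, _⟩
    let := metrizableSpaceMetric X
    have := UniformSpace.secondCountable_of_separable X
    exact .of_compactSpace
  tfae_finish
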